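/- Consider the call-by-value $\lambda$-calculus with shift and reset: terms $t ::= x \mid \lambda x.t \mid t\,t \mid \mathcal S k.t \mid \langle t\rangle$ up to $\alpha$-conversion, values $v ::= \lambda x.t$, pure contexts $E ::= \square \mid v\,E \mid E\,t$, evaluation contexts $F ::= \square \mid v\,F \mid F\,t \mid \langle F\rangle$, arbitrary one-hole contexts $C$ (whose filling may capture variables), and reduction $$F[(\lambda x.t)\,v]\to F[t\{v/x\}],\qquad F[\langle E[\mathcal S k.t]\rangle]\to F[\langle t\{\lambda x.\langle E[x]\rangle/k\}\rangle]\ (x\notin\mathrm{fv}(E)),\qquad F[\langle v\rangle]\to F[v].$$ Write $t\Downarrow t'$ if $t\to^* t'$ and $t'$ is irreducible. Programs $p$ are the terms of the form $\langle t\rangle$. Contextual equivalence for programs: $t_0\approx_c t_1$ if for all $C$ such that $\langle C[t_0]\rangle$ and $\langle C[t_1]\rangle$ are closed, $\langle C[t_0]\rangle\Downarrow v_0$ for some value $v_0$ if and only if $\langle C[t_1]\rangle\Downarrow v_1$ for some value $v_1$. Its evaluation-context version, on closed terms: $t_0\approx_e t_1$ if for all closed $F$, $\langle F[t_0]\rangle\Downarrow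 v_0$ for some value $v_0$ if and only if $\langle F[t_1]\rangle\Downarrow v_1$ for some value $v_1$. An environment $\mathcal E$ is a binary relation on closed values. An environmental relation $\mathcal X$ is a set of environments and of triples $(\mathcal E,t_0,t_1)$ with $t_0,t_1$ closed. Let $\widehat{\mathcal E}$ be the smallest relation on terms that contains $\mathcal E$ and is closed under all term constructors (including $x\mathrel{\widehat{\mathcal E}}x$ for variables), restricted to closed terms; on closed evaluation contexts let $\widetilde{\mathcal E}$ be the smallest relation with $\square\mathrel{\widetilde{\mathcal E}}\square$ that is closed under $v_0\,F_0,\,v_1\,F_1$ for $v_0\mathrel{\widehat{\mathcal E}}v_1$, under $F_0\,t_0,\,F_1\,t_1$ for $t_0\mathrel{\widehat{\mathcal E}}t_1$, and under $\langle F_0\rangle,\langle F_1\rangle$. $\mathcal X$ is an environmental bisimulation for programs if: 1. if $(\mathcal E,t_0,t_1)\in\mathcal X$ and $t_0,t_1$ are not both programs, then $(\mathcal E,\langle E_0[t_0]\rangle,\langle E_1[t_1]\rangle)\in\mathcal X$ for all pure $E_0\mathrel{\widetilde{\mathcal E}}E_1$; 2. if $(\mathcal E,p_0,p_1)\in\mathcal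 X$ with $p_0,p_1$ programs, then (a) $p_0\to p_0'$ with $p_0'$ a program implies $p_1\to^*p_1'$ and $(\mathcal E,p_0',p_1')\in\mathcal X$ for some program $p_1'$; (b) $p_0\to v_0$ with $v_0$ a value implies $p_1\to^*v_1$ and $\mathcal E\cup\{(v_0,v_1)\}\in\mathcal X$ for some value $v_1$; (c) conversely for the steps of $p_1$; 3. if $\mathcal E\in\mathcal X$, $\lambda x.t_0\mathrel{\mathcal E}\lambda x.t_1$ and $v_0\mathrel{\widehat{\mathcal E}}v_1$ are values, then $(\mathcal E,t_0\{v_0/x\},t_1\{v_1/x\})\in\mathcal X$. Let $\simeq$ be the relation $\{(t_0,t_1) : (\emptyset,t_0,t_1)\in\mathcal B\}$, where $\mathcal B$ is the largest environmental bisimulation for programs. **Lemma (Completeness).** $\approx_e\ \subseteq\ \simeq$. Moreover, on closed terms the three relations coincide: $t_0\approx_c t_1 \iff t_0\approx_e t_1\iff t_0\simeq t_1$ for all closed $t_0,t_1$. (The equivalence $t_0\approx_c t_1\iff t_0\approx_e t_1$ is a context lemma for $\approx_c$.) -/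

import Mathlib

namespace LamShift

/-- Terms of the call-by-value lambda-calculus with `shift` and `reset`, up to alpha-conversion
(de Bruijn indices): `lam t` and `shift t` each bind index `0` in `t`. -/
inductive Tm : Type
  | var (n : ℕ) : Tm
  | lam (t : Tm) : Tm
  | app (t u : Tm) : Tm
  | shift (t : Tm) : Tm
  | reset (t : Tm) : Tm

namespace Tm

/-- Values are the lambda-abstractions (variables are not values). -/
inductive IsValue : Tm → Prop
  | lam (t : Tm) : IsValue (lam t)

/-- Programs are the terms of the form `reset t`. -/
inductive IsProgram : Tm → Prop
  | reset (t : Tm) : IsProgram (reset t)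

/-- All free indices of the term are smaller than `n`. -/
def ClosedAt : ℕ → Tm → Prop
  | n, var i => i < n
  | n, lam t => ClosedAt (n + 1) t
  | n, app t u => ClosedAt n t ∧ ClosedAt n u
  | n, shift t => ClosedAt (n + 1) t
  | n, reset t => ClosedAt n t

/-- The term has no free variable. -/
def Closed (t : Tm) : Prop := ClosedAt 0 t

/-- Lifting of a renaming under a binder. -/
def upRen (ξ : ℕ → ℕ) : ℕ → ℕ
  | 0 => 0
  | n + 1 => ξ n + 1

/-- Renaming of the free variables. -/
def rename : (ℕ → ℕ) → Tm → Tm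
  | ξ, var i => var (ξ i)
  | ξ, lam t => lam (rename (upRen ξ) t)
  | ξ, app t u => app (rename ξ t) (rename ξ u)
  | ξ, shift t => shift (rename (upRen ξ) t)
  | ξ, reset t => reset (rename ξ t)

/-- Lifting of a substitution under a binder. -/
def upSub (σ : ℕ → Tm) : ℕ → Tm
  | 0 => var 0
  | n + 1 => rename Nat.succ (σ n)

/-- Parallel capture-avoiding substitution. -/
def subst : (ℕ → Tm) → Tm → Tm
  | σ, var i => σ i
  | σ, lam t => lam (subst (upSub σ) t)
  | σ, app t u => app (subst σ t) (subst σ u)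
  | σ, shift t => shift (subst (upSub σ) t)
  | σ, reset t => reset (subst σ t)

/-- The substitution replacing index `0` by `v` and lowering the other indices. -/
def single (v : Tm) : ℕ → Tm
  | 0 => v
  | n + 1 => var n

/-- `t.inst v` is `t{v/x}`, where `x` is the variable of index `0` of `t`, bound just outside
`t`. -/
def inst (t v : Tm) : Tm := subst (single v) t

end Tm

open Tm

/-- Call-by-value evaluation contexts `F ::= [] | v F | F t | reset F`. The value `v` is recorded
by the body of the abstraction: `appV b F` stands for `(lam b) F`. -/
inductive ECtx : Type
  | hole : ECtx
  | appV (b : Tm) (F : ECtx) : ECtx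
  | appT (F : ECtx) (t : Tm) : ECtx
  | reset (F : ECtx) : ECtx

namespace ECtx

/-- Filling of an evaluation context. -/
def fill : ECtx → Tm → Tm
  | hole, s => s
  | appV b F, s => app (lam b) (fill F s)
  | appT F t, s => app (fill F s) t
  | reset F, s => Tm.reset (fill F s)

/-- Pure contexts `E ::= [] | v E | E t`: the evaluation contexts without `reset` around the
hole. -/
def IsPure : ECtx → Prop
  | hole => True
  | appV _ F => IsPure F
  | appT F _ => IsPure F
  | reset _ => False

/-- The context has no free variable. -/
def Closed : ECtx → Prop
  | hole => True
  | appV b F => (lam b).Closed ∧ Closed F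
  | appT F t => Closed F ∧ t.Closed
  | reset F => Closed F

/-- Renaming of the free variables of an evaluation context (the hole is under no binder). -/
def rename (ξ : ℕ → ℕ) : ECtx → ECtx
  | hole => hole
  | appV b F => appV (Tm.rename (upRen ξ) b) (rename ξ F)
  | appT F t => appT (rename ξ F) (Tm.rename ξ t)
  | reset F => reset (rename ξ F)

end ECtx

/-- Arbitrary one-hole contexts `C`. -/
inductive Ctx : Type
  | hole : Ctx
  | lam (C : Ctx) : Ctx
  | appR (t : Tm) (C : Ctx) : Ctx
  | appL (C : Ctx) (t : Tm) : Ctx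
  | shift (C : Ctx) : Ctx
  | reset (C : Ctx) : Ctx

/-- Filling of a context; free variables of the filling term may be captured. -/
def Ctx.fill : Ctx → Tm → Tm
  | .hole, s => s
  | .lam C, s => .lam (C.fill s)
  | .appR t C, s => .app t (C.fill s)
  | .appL C t, s => .app (C.fill s) t
  | .shift C, s => .shift (C.fill s)
  | .reset C, s => .reset (C.fill s)

/-- The reified captured continuation `lam x. reset E[x]`, with `x` not free in `E`. -/
def reify (E : ECtx) : Tm := lam (reset ((E.rename Nat.succ).fill (var 0)))

/-- Call-by-value reduction. -/
inductive Red : Tm → Tm → Prop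
  | beta (F : ECtx) (t v : Tm) : v.IsValue →
      Red (F.fill (app (lam t) v)) (F.fill (t.inst v))
  | shift (F E : ECtx) (t : Tm) : E.IsPure →
      Red (F.fill (reset (E.fill (Tm.shift t)))) (F.fill (reset (t.inst (reify E))))
  | reset (F : ECtx) (v : Tm) : v.IsValue →
      Red (F.fill (Tm.reset v)) (F.fill v)

/-- Reflexive and transitive closure of reduction. -/
def Reds : Tm → Tm → Prop := Relation.ReflTransGen Red

/-- Evaluation: `t` reduces in zero or more steps to the irreducible term `t'`. -/
def Eval (t t' : Tm) : Prop := Reds t t' ∧ ∀ u, ¬ Red t' u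

/-- `t` evaluates to some value. -/
def EvalsToValue (t : Tm) : Prop := ∃ v : Tm, v.IsValue ∧ Eval t v

/-- Contextual equivalence for programs: the terms are tested in the closing contexts
`reset C`. -/
def CtxEquivP (t₀ t₁ : Tm) : Prop :=
  ∀ C : Ctx, (reset (C.fill t₀)).Closed → (reset (C.fill t₁)).Closed →
    (EvalsToValue (reset (C.fill t₀)) ↔ EvalsToValue (reset (C.fill t₁)))

/-- Evaluation-context equivalence for programs, a relation on closed terms: they are tested in
`reset F` for the closed evaluation contexts `F`. -/
def CtxEquivEP (t₀ t₁ : Tm) : Prop :=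
  t₀.Closed ∧ t₁.Closed ∧ ∀ F : ECtx, F.Closed →
    (EvalsToValue (reset (F.fill t₀)) ↔ EvalsToValue (reset (F.fill t₁)))

/-- Binary relations on terms, as sets of pairs. -/
abbrev TmRel : Type := Set (Tm × Tm)

/-- The term generating closure of a relation, on open terms. -/
inductive CloOpen (R : TmRel) : Tm → Tm → Prop
  | base {t t' : Tm} : (t, t') ∈ R → CloOpen R t t'
  | var (n : ℕ) : CloOpen R (Tm.var n) (Tm.var n)
  | lam {t t' : Tm} : CloOpen R t t' → CloOpen R (Tm.lam t) (Tm.lam t')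
  | app {t t' u u' : Tm} : CloOpen R t t' → CloOpen R u u' → CloOpen R (Tm.app t u) (Tm.app t' u')
  | shift {t t' : Tm} : CloOpen R t t' → CloOpen R (Tm.shift t) (Tm.shift t')
  | reset {t t' : Tm} : CloOpen R t t' → CloOpen R (Tm.reset t) (Tm.reset t')

/-- The term generating closure, restricted to closed terms. -/
def Clo (R : TmRel) (t t' : Tm) : Prop := CloOpen R t t' ∧ t.Closed ∧ t'.Closed

/-- The context generating closure, on closed evaluation contexts. -/
inductive CloCtx (R : TmRel) : ECtx → ECtx → Prop
  | hole : CloCtx R ECtx.hole ECtx.hole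
  | appV {F F' : ECtx} {b b' : Tm} : CloCtx R F F' → Clo R (Tm.lam b) (Tm.lam b') →
      CloCtx R (ECtx.appV b F) (ECtx.appV b' F')
  | appT {F F' : ECtx} {t t' : Tm} : CloCtx R F F' → Clo R t t' →
      CloCtx R (ECtx.appT F t) (ECtx.appT F' t')
  | reset {F F' : ECtx} : CloCtx R F F' → CloCtx R (ECtx.reset F) (ECtx.reset F')

/-- An environment is a relation on closed values. -/
def IsEnv (e : TmRel) : Prop :=
  ∀ v w : Tm, (v, w) ∈ e → (v.IsValue ∧ v.Closed) ∧ (w.IsValue ∧ w.Closed)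

/-- An environmental relation: a set of environments together with a set of triples
`(e, t₀, t₁)` with `e` an environment and `t₀`, `t₁` closed terms. -/
structure EnvRel where
  envs : Set TmRel
  triples : Set (TmRel × Tm × Tm)
  isEnv_of_mem : ∀ e ∈ envs, IsEnv e
  wf_of_mem : ∀ e t₀ t₁, (e, t₀, t₁) ∈ triples → IsEnv e ∧ t₀.Closed ∧ t₁.Closed

/-- Environmental bisimulations for programs. -/
structure IsBisimP (R : EnvRel) : Prop where
  /-- Terms that are not both programs are put in related pure contexts, under a `reset`. -/
  plug : ∀ e t₀ t₁, (e, t₀, t₁) ∈ R.triples → ¬ (t₀.IsProgram ∧ t₁.IsProgram) →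
    ∀ E₀ E₁ : ECtx, E₀.IsPure → E₁.IsPure → CloCtx e E₀ E₁ →
      (e, reset (E₀.fill t₀), reset (E₁.fill t₁)) ∈ R.triples
  /-- A step from a program on the left to a program. -/
  stepL : ∀ e p₀ p₁, (e, p₀, p₁) ∈ R.triples → p₀.IsProgram → p₁.IsProgram →
    ∀ p₀' : Tm, p₀'.IsProgram → Red p₀ p₀' →
      ∃ p₁' : Tm, p₁'.IsProgram ∧ Reds p₁ p₁' ∧ (e, p₀', p₁') ∈ R.triples
  /-- A step from a program on the left to a value. -/
  valueL : ∀ e p₀ p₁, (e, p₀, p₁) ∈ R.triples → p₀.IsProgram → p₁.IsProgram →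
    ∀ v₀ : Tm, v₀.IsValue → Red p₀ v₀ →
      ∃ v₁ : Tm, v₁.IsValue ∧ Reds p₁ v₁ ∧ insert (v₀, v₁) e ∈ R.envs
  /-- A step from a program on the right to a program. -/
  stepR : ∀ e p₀ p₁, (e, p₀, p₁) ∈ R.triples → p₀.IsProgram → p₁.IsProgram →
    ∀ p₁' : Tm, p₁'.IsProgram → Red p₁ p₁' →
      ∃ p₀' : Tm, p₀'.IsProgram ∧ Reds p₀ p₀' ∧ (e, p₀', p₁') ∈ R.triples
  /-- A step from a program on the right to a value. -/
  valueR : ∀ e p₀ p₁, (e, p₀, p₁) ∈ R.triples → p₀.IsProgram → p₁.IsProgram →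
    ∀ v₁ : Tm, v₁.IsValue → Red p₁ v₁ →
      ∃ v₀ : Tm, v₀.IsValue ∧ Reds p₀ v₀ ∧ insert (v₀, v₁) e ∈ R.envs
  /-- Related functions are applied to the related closed values built from the environment. -/
  apply : ∀ e ∈ R.envs, ∀ b₀ b₁ : Tm, (lam b₀, lam b₁) ∈ e →
    ∀ v₀ v₁ : Tm, v₀.IsValue → v₁.IsValue → Clo e v₀ v₁ →
      (e, b₀.inst v₀, b₁.inst v₁) ∈ R.triples

/-- Environmental bisimilarity for programs: the union of all environmental bisimulations for
programs, which is the largest one by the two facts below. -/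
def bisimilarityP : EnvRel where
  envs := {e | ∃ R, IsBisimP R ∧ e ∈ R.envs}
  triples := {x | ∃ R, IsBisimP R ∧ x ∈ R.triples}
  isEnv_of_mem := fun e ⟨R, _, h⟩ => R.isEnv_of_mem e h
  wf_of_mem := fun e t₀ t₁ ⟨R, _, h⟩ => R.wf_of_mem e t₀ t₁ h

theorem isBisimP_bisimilarityP : IsBisimP bisimilarityP where
  plug := fun e t₀ t₁ ⟨R, hR, h⟩ hn E₀ E₁ h₀ h₁ hE =>
    ⟨R, hR, hR.plug e t₀ t₁ h hn E₀ E₁ h₀ h₁ hE⟩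
  stepL := fun e p₀ p₁ ⟨R, hR, h⟩ h₀ h₁ q hq hr =>
    let ⟨q', a, b, c⟩ := hR.stepL e p₀ p₁ h h₀ h₁ q hq hr
    ⟨q', a, b, R, hR, c⟩
  valueL := fun e p₀ p₁ ⟨R, hR, h⟩ h₀ h₁ q hq hr =>
    let ⟨q', a, b, c⟩ := hR.valueL e p₀ p₁ h h₀ h₁ q hq hr
    ⟨q', a, b, R, hR, c⟩
  stepR := fun e p₀ p₁ ⟨R, hR, h⟩ h₀ h₁ q hq hr =>
    let ⟨q', a, b, c⟩ := hR.stepR e p₀ p₁ h h₀ h₁ q hq hr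
    ⟨q', a, b, R, hR, c⟩
  valueR := fun e p₀ p₁ ⟨R, hR, h⟩ h₀ h₁ q hq hr =>
    let ⟨q', a, b, c⟩ := hR.valueR e p₀ p₁ h h₀ h₁ q hq hr
    ⟨q', a, b, R, hR, c⟩
  apply := fun e ⟨R, hR, h⟩ b₀ b₁ hb v₀ v₁ h₀ h₁ hv =>
    ⟨R, hR, hR.apply e h b₀ b₁ hb v₀ v₁ h₀ h₁ hv⟩

theorem IsBisimP.le_bisimilarityP {R : EnvRel} (hR : IsBisimP R) :
    R.envs ⊆ bisimilarityP.envs ∧ R.triples ⊆ bisimilarityP.triples :=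
  ⟨fun _ h => ⟨R, hR, h⟩, fun _ h => ⟨R, hR, h⟩⟩

/-- Bisimilarity for programs of two terms without any predefined knowledge, i.e. for the empty
environment. -/
def EmpBisimP (t₀ t₁ : Tm) : Prop := ((∅ : TmRel), t₀, t₁) ∈ bisimilarityP.triples

end LamShift

/-!
Reduction is deterministic and a closed term under a `reset` is never stuck, so termination can be
compared step by step. The tool for this is `Clo.reset_cases`, a consequence of
`CloOpen.jointEval`: two closed terms under a `reset` that are related by the term closure of a
relation `R` are both values, or reduce to related terms, or have a pair of `R` at evaluation
position, as the function that is applied or as a term still to be evaluated.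

* Completeness. The environmental relation `observational` consists of the triples `(e, t, t')`
  whose terms terminate alike in all contexts related by `e`, and of the environments whose closure
  relates terms that terminate alike. It is a bisimulation: a step does not change termination, and
  when the terms evaluate to `v` and `v'`, the terms built from `e` and `(v, v')` are reached by
  applying functions built from `e` to the two terms. For the empty environment, related contexts
  are equal and its triples are exactly the pairs of `CtxEquivEP`.
* Soundness in evaluation contexts. For a bisimulation, `IsBisimP.evalsToValue_aux` shows by
  induction on the number of steps that termination is preserved, simultaneously for terms related
  by the closure of an environment and for terms of a triple in related contexts. The converse of a
  bisimulation is a bisimulation, which gives the other direction.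
* Context lemma. For closed `t`, the term `delay t = (lam _. t) (lam x. x)` replaces `t` in
  arbitrary contexts without loss of termination (`evalsToValue_delay`). Now `delay t`, being
  neither a value nor a `shift`, is harmless until it comes to evaluation position, where it takes a
  step. This step makes an induction on the number of steps possible that replaces `delay t` by any
  `t'` equivalent to `t` in evaluation contexts (`CtxEquivEP.evalsToValue_of_delay`).
-/

namespace LamShift

open Tm

/-! ### Closed terms, renaming and substitution -/

theorem Tm.ClosedAt.rename_eq {t : Tm} : ∀ {n : ℕ} {ξ : ℕ → ℕ}, t.ClosedAt n →
    (∀ i < n, ξ i = i) → t.rename ξ = t := by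
  have up : ∀ {n : ℕ} {ξ : ℕ → ℕ}, (∀ i < n, ξ i = i) → ∀ i < n + 1, upRen ξ i = i := by
    intro n ξ h i hi
    cases i with
    | zero => rfl
    | succ i => simp [upRen, h i (by omega)]
  induction t with
  | var i => intro n ξ ht h; simp [Tm.rename, h i ht]
  | lam t ih => intro n ξ ht h; simp [Tm.rename, ih ht (up h)]
  | shift t ih => intro n ξ ht h; simp [Tm.rename, ih ht (up h)]
  | reset t ih => intro n ξ ht h; simp [Tm.rename, ih ht h]
  | app t u iht ihu => intro n ξ ht h; simp [Tm.rename, iht ht.1 h, ihu ht.2 h]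

theorem Tm.Closed.rename_eq {t : Tm} (ht : t.Closed) (ξ : ℕ → ℕ) : t.rename ξ = t :=
  ClosedAt.rename_eq ht (by simp)

theorem upSub_eq_var {n : ℕ} {σ : ℕ → Tm} (h : ∀ i < n, σ i = var i) :
    ∀ i < n + 1, upSub σ i = var i := by
  intro i hi
  cases i with
  | zero => rfl
  | succ i => simp [upSub, h i (by omega), Tm.rename]

theorem Tm.ClosedAt.subst_eq {t : Tm} : ∀ {n : ℕ} {σ : ℕ → Tm}, t.ClosedAt n →
    (∀ i < n, σ i = var i) → t.subst σ = t := by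
  induction t with
  | var i => intro n σ ht h; simp [Tm.subst, h i ht]
  | lam t ih => intro n σ ht h; simp [Tm.subst, ih ht (upSub_eq_var h)]
  | shift t ih => intro n σ ht h; simp [Tm.subst, ih ht (upSub_eq_var h)]
  | reset t ih => intro n σ ht h; simp [Tm.subst, ih ht h]
  | app t u iht ihu => intro n σ ht h; simp [Tm.subst, iht ht.1 h, ihu ht.2 h]

theorem Tm.Closed.subst_eq {t : Tm} (ht : t.Closed) (σ : ℕ → Tm) : t.subst σ = t :=
  ClosedAt.subst_eq ht (by simp)

theorem Tm.ClosedAt.rename {t : Tm} : ∀ {n m : ℕ} {ξ : ℕ → ℕ}, t.ClosedAt n →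
    (∀ i < n, ξ i < m) → (t.rename ξ).ClosedAt m := by
  have up : ∀ {n m : ℕ} {ξ : ℕ → ℕ}, (∀ i < n, ξ i < m) →
      ∀ i < n + 1, upRen ξ i < m + 1 := by
    intro n m ξ h i hi
    cases i with
    | zero => simp [upRen]
    | succ i => simpa [upRen] using h i (by omega)
  induction t with
  | var i => intro n m ξ ht h; exact h i ht
  | lam t ih => intro n m ξ ht h; exact ih (n := n + 1) (m := m + 1) ht (up h)
  | shift t ih => intro n m ξ ht h; exact ih (n := n + 1) (m := m + 1) ht (up h)
  | reset t ih => intro n m ξ ht h; exact ih (n := n) (m := m) ht h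
  | app t u iht ihu => intro n m ξ ht h; exact ⟨iht ht.1 h, ihu ht.2 h⟩

theorem Tm.ClosedAt.subst {t : Tm} : ∀ {n m : ℕ} {σ : ℕ → Tm}, t.ClosedAt n →
    (∀ i < n, (σ i).ClosedAt m) → (t.subst σ).ClosedAt m := by
  have up : ∀ {n m : ℕ} {σ : ℕ → Tm}, (∀ i < n, (σ i).ClosedAt m) →
      ∀ i < n + 1, (upSub σ i).ClosedAt (m + 1) := by
    intro n m σ h i hi
    cases i with
    | zero => simp [upSub, ClosedAt]
    | succ i => exact (h i (by omega)).rename (by intro j hj; simpa using hj)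
  induction t with
  | var i => intro n m σ ht h; exact h i ht
  | lam t ih => intro n m σ ht h; exact ih (n := n + 1) (m := m + 1) ht (up h)
  | shift t ih => intro n m σ ht h; exact ih (n := n + 1) (m := m + 1) ht (up h)
  | reset t ih => intro n m σ ht h; exact ih (n := n) (m := m) ht h
  | app t u iht ihu => intro n m σ ht h; exact ⟨iht ht.1 h, ihu ht.2 h⟩

theorem Tm.ClosedAt.mono {t : Tm} : ∀ {n m : ℕ}, t.ClosedAt n → n ≤ m → t.ClosedAt m := by
  induction t with
  | var i => intro n m ht h; exact lt_of_lt_of_le ht h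
  | lam t ih => intro n m ht h; exact ih (n := n + 1) (m := m + 1) ht (by omega)
  | shift t ih => intro n m ht h; exact ih (n := n + 1) (m := m + 1) ht (by omega)
  | reset t ih => intro n m ht h; exact ih (n := n) (m := m) ht h
  | app t u iht ihu => intro n m ht h; exact ⟨iht ht.1 h, ihu ht.2 h⟩

theorem Tm.ClosedAt.inst {t v : Tm} (ht : t.ClosedAt 1) (hv : v.Closed) :
    (t.inst v).Closed := by
  refine ClosedAt.subst ht ?_
  intro i hi
  obtain rfl : i = 0 := by omega
  exact hv

theorem ECtx.closedAt_fill {F : ECtx} {t : Tm} {n : ℕ} (hF : F.Closed) (ht : t.ClosedAt n) :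
    (F.fill t).ClosedAt n := by
  induction F with
  | hole => exact ht
  | appV b F ih => exact ⟨ClosedAt.mono (t := lam b) hF.1 (Nat.zero_le _), ih hF.2⟩
  | appT F u ih => exact ⟨ih hF.1, ClosedAt.mono hF.2 (Nat.zero_le _)⟩
  | reset F ih => exact ih (by exact hF)

theorem ECtx.closed_of_fill {F : ECtx} {t : Tm} (h : (F.fill t).Closed) :
    F.Closed ∧ t.Closed := by
  induction F with
  | hole => exact ⟨trivial, h⟩
  | appV b F ih => exact ⟨⟨h.1, (ih h.2).1⟩, (ih h.2).2⟩
  | appT F u ih => exact ⟨⟨(ih h.1).1, h.2⟩, (ih h.1).2⟩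
  | reset F ih => exact ih h

theorem ECtx.Closed.rename_eq {F : ECtx} (hF : F.Closed) (ξ : ℕ → ℕ) : F.rename ξ = F := by
  induction F with
  | hole => rfl
  | appV b F ih =>
    have hb : Tm.rename ξ (lam b) = lam b := Tm.Closed.rename_eq hF.1 ξ
    simp only [Tm.rename, lam.injEq] at hb
    simp [ECtx.rename, hb, ih hF.2]
  | appT F u ih => simp [ECtx.rename, ih hF.1, Tm.Closed.rename_eq hF.2]
  | reset F ih => simp [ECtx.rename, ih hF]

theorem reify_eq {E : ECtx} (hE : E.Closed) : reify E = lam (reset (E.fill (var 0))) := by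
  rw [reify, hE.rename_eq]

theorem closed_reify {E : ECtx} (hE : E.Closed) : (reify E).Closed := by
  rw [reify_eq hE]
  exact ECtx.closedAt_fill (n := 1) hE (by simp [ClosedAt])

theorem Red.closed {t t' : Tm} (h : Red t t') (ht : t.Closed) : t'.Closed := by
  cases h with
  | beta F b v hv =>
    obtain ⟨hF, h⟩ := ECtx.closed_of_fill ht
    exact ECtx.closedAt_fill hF (ClosedAt.inst h.1 h.2)
  | shift F E b hE =>
    obtain ⟨hF, h⟩ := ECtx.closed_of_fill ht
    obtain ⟨hE', h⟩ := ECtx.closed_of_fill (F := E) h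
    exact ECtx.closedAt_fill hF (ClosedAt.inst (t := b) h (closed_reify hE'))
  | reset F v hv =>
    obtain ⟨hF, h⟩ := ECtx.closed_of_fill ht
    exact ECtx.closedAt_fill hF h

theorem Reds.closed {t t' : Tm} (h : Reds t t') (ht : t.Closed) : t'.Closed := by
  induction h with
  | refl => exact ht
  | tail _ h ih => exact h.closed ih

/-! ### Determinism and evaluation -/

/-- Composition of evaluation contexts: `F.comp G` fills the hole of `F` with `G`. -/
def ECtx.comp : ECtx → ECtx → ECtx
  | hole, G => G
  | appV b F, G => appV b (comp F G)
  | appT F t, G => appT (comp F G) t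
  | reset F, G => reset (comp F G)

theorem ECtx.fill_comp (F G : ECtx) (t : Tm) : (F.comp G).fill t = F.fill (G.fill t) := by
  induction F <;> simp [ECtx.comp, ECtx.fill, *]

theorem Red.fill {t t' : Tm} (F : ECtx) (h : Red t t') : Red (F.fill t) (F.fill t') := by
  cases h with
  | beta G b v hv => rw [← F.fill_comp, ← F.fill_comp]; exact .beta _ _ _ hv
  | shift G E b hE => rw [← F.fill_comp, ← F.fill_comp]; exact .shift _ _ _ hE
  | reset G v hv => rw [← F.fill_comp, ← F.fill_comp]; exact .reset _ _ hv

theorem Reds.fill {t t' : Tm} (F : ECtx) (h : Reds t t') : Reds (F.fill t) (F.fill t') :=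
  Relation.ReflTransGen.lift F.fill (fun _ _ hr => Red.fill F hr) _ _ h

/-- What the search for the next reduction in a term finds: the body of a value, a `shift`
together with the pure context that surrounds it, the reduct, or a free variable in evaluation
position. -/
inductive Outcome : Type
  | value (b : Tm) : Outcome
  | capture (E : ECtx) (b : Tm) : Outcome
  | step (t : Tm) : Outcome
  | free : Outcome

/-- The search for the next reduction, by recursion on the term. -/
def outcome : Tm → Outcome
  | var _ => .free
  | lam b => .value b
  | Tm.shift b => .capture .hole b
  | reset t =>
    match outcome t with
    | .value _ => .step t
    | .capture E b => .step (reset (b.inst (reify E)))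
    | .step t' => .step (reset t')
    | .free => .free
  | app t u =>
    match outcome t with
    | .value b =>
      match outcome u with
      | .value _ => .step (b.inst u)
      | .capture E c => .capture (.appV b E) c
      | .step u' => .step (app t u')
      | .free => .free
    | .capture E b => .capture (.appT E u) b
    | .step t' => .step (app t' u)
    | .free => .free

theorem outcome_fill_of_step {t t' : Tm} (F : ECtx) (h : outcome t = .step t') :
    outcome (F.fill t) = .step (F.fill t') := by
  induction F <;> simp [ECtx.fill, outcome, *]

theorem outcome_fill_shift {E : ECtx} (hE : E.IsPure) (b : Tm) :
    outcome (E.fill (Tm.shift b)) = .capture E b := by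
  induction E with
  | hole => rfl
  | appV c F ih => simp [ECtx.fill, outcome, ih hE]
  | appT F u ih => simp [ECtx.fill, outcome, ih hE]
  | reset F ih => exact hE.elim

theorem Red.outcome_eq {t t' : Tm} (h : Red t t') : outcome t = .step t' := by
  cases h with
  | beta F b v hv => cases hv; exact outcome_fill_of_step F (by simp [outcome])
  | shift F E b hE =>
    exact outcome_fill_of_step F (by simp [outcome, outcome_fill_shift hE])
  | reset F v hv => cases hv; exact outcome_fill_of_step F (by simp [outcome])

theorem Red.deterministic {t t₁ t₂ : Tm} (h₁ : Red t t₁) (h₂ : Red t t₂) : t₁ = t₂ := by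
  simpa using h₁.outcome_eq.symm.trans h₂.outcome_eq

theorem Tm.IsValue.not_red {v t : Tm} (hv : v.IsValue) : ¬ Red v t := by
  intro h
  cases hv
  simpa [outcome] using h.outcome_eq

/-- `HaltsIn n t`: the term `t` reaches a value in exactly `n` steps. -/
inductive HaltsIn : ℕ → Tm → Prop
  | value {v : Tm} : v.IsValue → HaltsIn 0 v
  | step {n : ℕ} {t t' : Tm} : Red t t' → HaltsIn n t' → HaltsIn (n + 1) t

theorem evalsToValue_iff_haltsIn {t : Tm} : EvalsToValue t ↔ ∃ n, HaltsIn n t := by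
  constructor
  · rintro ⟨v, hv, h, -⟩
    induction h using Relation.ReflTransGen.head_induction_on with
    | refl => exact ⟨0, .value hv⟩
    | head h _ ih => obtain ⟨n, hn⟩ := ih; exact ⟨n + 1, .step h hn⟩
  · rintro ⟨n, h⟩
    induction h with
    | value hv => exact ⟨_, hv, .refl, fun _ => hv.not_red⟩
    | step h _ ih => obtain ⟨v, hv, hr, hi⟩ := ih; exact ⟨v, hv, .head h hr, hi⟩

theorem HaltsIn.of_red {n : ℕ} {t t' : Tm} (hn : HaltsIn n t) (h : Red t t') :
    ∃ m < n, HaltsIn m t' := by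
  cases hn with
  | value hv => exact (hv.not_red h).elim
  | step h' hm => exact ⟨_, Nat.lt_succ_self _, h'.deterministic h ▸ hm⟩

theorem Tm.IsValue.evalsToValue {v : Tm} (hv : v.IsValue) : EvalsToValue v :=
  evalsToValue_iff_haltsIn.2 ⟨0, .value hv⟩

theorem Red.evalsToValue_iff {t t' : Tm} (h : Red t t') : EvalsToValue t ↔ EvalsToValue t' := by
  simp only [evalsToValue_iff_haltsIn]
  constructor
  · rintro ⟨n, hn⟩
    obtain ⟨m, -, hm⟩ := hn.of_red h
    exact ⟨m, hm⟩
  · rintro ⟨n, hn⟩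
    exact ⟨n + 1, .step h hn⟩

theorem Reds.evalsToValue_iff {t t' : Tm} (h : Reds t t') :
    EvalsToValue t ↔ EvalsToValue t' := by
  induction h with
  | refl => rfl
  | tail _ h ih => exact ih.trans h.evalsToValue_iff

theorem red_beta (F : ECtx) {b v : Tm} (hv : v.IsValue) :
    Red (reset (F.fill (app (lam b) v))) (reset (F.fill (b.inst v))) :=
  .beta (.reset F) b v hv

/-! ### Closures of relations -/

theorem CloOpen.refl (R : TmRel) (t : Tm) : CloOpen R t t := by
  induction t with
  | var n => exact .var n
  | lam t ih => exact .lam ih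
  | app t u iht ihu => exact .app iht ihu
  | shift t ih => exact .shift ih
  | reset t ih => exact .reset ih

theorem Clo.refl (R : TmRel) {t : Tm} (ht : t.Closed) : Clo R t t := ⟨.refl R t, ht, ht⟩

theorem CloCtx.refl (R : TmRel) {F : ECtx} (hF : F.Closed) : CloCtx R F F := by
  induction F with
  | hole => exact .hole
  | appV b F ih => exact .appV (ih hF.2) (.refl R hF.1)
  | appT F u ih => exact .appT (ih hF.1) (.refl R hF.2)
  | reset F ih => exact .reset (ih hF)

theorem CloCtx.closed {R : TmRel} {F F' : ECtx} (h : CloCtx R F F') : F.Closed ∧ F'.Closed := by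
  induction h with
  | hole => exact ⟨trivial, trivial⟩
  | appV _ hb ih => exact ⟨⟨hb.2.1, ih.1⟩, ⟨hb.2.2, ih.2⟩⟩
  | appT _ ht ih => exact ⟨⟨ih.1, ht.2.1⟩, ⟨ih.2, ht.2.2⟩⟩
  | reset _ ih => exact ih

theorem CloCtx.fill_cloOpen {R : TmRel} {F F' : ECtx} {t t' : Tm} (h : CloCtx R F F')
    (ht : CloOpen R t t') : CloOpen R (F.fill t) (F'.fill t') := by
  induction h with
  | hole => exact ht
  | appV _ hb ih => exact .app hb.1 ih
  | appT _ hu ih => exact .app ih hu.1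
  | reset _ ih => exact .reset ih

theorem CloCtx.fill_clo {R : TmRel} {F F' : ECtx} {t t' : Tm} (h : CloCtx R F F')
    (ht : Clo R t t') : Clo R (F.fill t) (F'.fill t') :=
  ⟨h.fill_cloOpen ht.1, ECtx.closedAt_fill h.closed.1 ht.2.1,
    ECtx.closedAt_fill h.closed.2 ht.2.2⟩

theorem CloCtx.comp {R : TmRel} {F F' G G' : ECtx} (h : CloCtx R F F') (hG : CloCtx R G G') :
    CloCtx R (F.comp G) (F'.comp G') := by
  induction h with
  | hole => exact hG
  | appV _ hb ih => exact .appV ih hb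
  | appT _ hu ih => exact .appT ih hu
  | reset _ ih => exact .reset ih

theorem CloOpen.mono {R S : TmRel} (hRS : R ⊆ S) {t t' : Tm} (h : CloOpen R t t') :
    CloOpen S t t' := by
  induction h with
  | base h => exact .base (hRS h)
  | var n => exact .var n
  | lam _ ih => exact .lam ih
  | app _ _ iht ihu => exact .app iht ihu
  | shift _ ih => exact .shift ih
  | reset _ ih => exact .reset ih

theorem Clo.mono {R S : TmRel} (hRS : R ⊆ S) {t t' : Tm} (h : Clo R t t') : Clo S t t' :=
  ⟨h.1.mono hRS, h.2⟩

theorem CloCtx.mono {R S : TmRel} (hRS : R ⊆ S) {F F' : ECtx} (h : CloCtx R F F') :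
    CloCtx S F F' := by
  induction h with
  | hole => exact .hole
  | appV _ hb ih => exact .appV ih (hb.mono hRS)
  | appT _ hu ih => exact .appT ih (hu.mono hRS)
  | reset _ ih => exact .reset ih

theorem CloOpen.eq_of_empty {t t' : Tm} (h : CloOpen ∅ t t') : t = t' := by
  induction h with
  | base h => exact h.elim
  | var n => rfl
  | lam _ ih => rw [ih]
  | app _ _ iht ihu => rw [iht, ihu]
  | shift _ ih => rw [ih]
  | reset _ ih => rw [ih]

theorem CloCtx.eq_of_empty {F F' : ECtx} (h : CloCtx ∅ F F') : F = F' := by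
  induction h with
  | hole => rfl
  | appV _ hb ih => rw [ih, lam.inj hb.1.eq_of_empty]
  | appT _ hu ih => rw [ih, hu.1.eq_of_empty]
  | reset _ ih => rw [ih]

/-- A relation on closed terms that relates values on the left to values only. Environments are
of this kind; so is a relation whose left-hand terms are applications. -/
def ValuePreserving (R : TmRel) : Prop :=
  ∀ t t' : Tm, (t, t') ∈ R → t.Closed ∧ t'.Closed ∧ (t.IsValue → t'.IsValue)

theorem IsEnv.valuePreserving {e : TmRel} (he : IsEnv e) : ValuePreserving e :=
  fun t t' h => ⟨(he t t' h).1.2, (he t t' h).2.2, fun _ => (he t t' h).2.1⟩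

theorem CloOpen.rename {R : TmRel} (hR : ValuePreserving R) {t t' : Tm} (h : CloOpen R t t') :
    ∀ ξ, CloOpen R (t.rename ξ) (t'.rename ξ) := by
  induction h with
  | base h =>
    intro ξ
    rw [(hR _ _ h).1.rename_eq, (hR _ _ h).2.1.rename_eq]
    exact .base h
  | var n => intro ξ; exact .var _
  | lam _ ih => intro ξ; exact .lam (ih _)
  | app _ _ iht ihu => intro ξ; exact .app (iht ξ) (ihu ξ)
  | shift _ ih => intro ξ; exact .shift (ih _)
  | reset _ ih => intro ξ; exact .reset (ih ξ)

theorem CloOpen.subst {R : TmRel} (hR : ValuePreserving R) {t t' : Tm} (h : CloOpen R t t') :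
    ∀ {σ σ' : ℕ → Tm}, (∀ i, CloOpen R (σ i) (σ' i)) →
      CloOpen R (t.subst σ) (t'.subst σ') := by
  have up : ∀ {σ σ' : ℕ → Tm}, (∀ i, CloOpen R (σ i) (σ' i)) →
      ∀ i, CloOpen R (upSub σ i) (upSub σ' i) := by
    intro σ σ' h i
    cases i with
    | zero => exact .var 0
    | succ i => exact (h i).rename hR _
  induction h with
  | base h =>
    intro σ σ' _
    rw [(hR _ _ h).1.subst_eq, (hR _ _ h).2.1.subst_eq]
    exact .base h
  | var n => intro σ σ' hσ; exact hσ n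
  | lam _ ih => intro σ σ' hσ; exact .lam (ih (up hσ))
  | app _ _ iht ihu => intro σ σ' hσ; exact .app (iht hσ) (ihu hσ)
  | shift _ ih => intro σ σ' hσ; exact .shift (ih (up hσ))
  | reset _ ih => intro σ σ' hσ; exact .reset (ih hσ)

theorem CloOpen.inst {R : TmRel} (hR : ValuePreserving R) {t t' v v' : Tm}
    (h : CloOpen R t t') (hv : CloOpen R v v') : CloOpen R (t.inst v) (t'.inst v') := by
  refine h.subst hR ?_
  rintro (_ | i)
  · exact hv
  · exact .var i

theorem CloCtx.reify {R : TmRel} {E E' : ECtx} (h : CloCtx R E E') :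
    CloOpen R (LamShift.reify E) (LamShift.reify E') := by
  rw [reify_eq h.closed.1, reify_eq h.closed.2]
  exact .lam (.reset (h.fill_cloOpen (.var 0)))

/-! ### Evaluation of related terms -/

/-- The joint cases for the evaluation of two related closed terms. The two terms are values, or
capture related pure contexts, or reduce to related terms, or apply related functions of `R` itself
to related values, or have at evaluation position a pair of `R` that is not a value on the
left. -/
inductive JointEval (R : TmRel) : Tm → Tm → Prop
  | value {t t' : Tm} : t.IsValue → t'.IsValue → JointEval R t t'
  | capture {E E' : ECtx} {b b' : Tm} : E.IsPure → E'.IsPure → CloCtx R E E' →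
      CloOpen R b b' → JointEval R (E.fill (Tm.shift b)) (E'.fill (Tm.shift b'))
  | step {t t' u u' : Tm} : Red t u → Red t' u' → CloOpen R u u' → JointEval R t t'
  | apply {F F' : ECtx} {b b' v v' : Tm} : CloCtx R F F' → (lam b, lam b') ∈ R →
      v.IsValue → v'.IsValue → Clo R v v' →
      JointEval R (F.fill (app (lam b) v)) (F'.fill (app (lam b') v'))
  | base {F F' : ECtx} {t t' : Tm} : CloCtx R F F' → (t, t') ∈ R → ¬ t.IsValue →
      JointEval R (F.fill t) (F'.fill t')

theorem CloOpen.jointEval {R : TmRel} (hR : ValuePreserving R) {t t' : Tm}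
    (h : CloOpen R t t') (ht : t.Closed) (ht' : t'.Closed) : JointEval R t t' := by
  induction h with
  | @base t t' h =>
    by_cases hv : t.IsValue
    · exact .value hv ((hR _ _ h).2.2 hv)
    · exact .base (F := .hole) (F' := .hole) .hole h hv
  | var n => exact absurd ht (Nat.not_lt_zero n)
  | lam _ _ => exact .value (.lam _) (.lam _)
  | shift h _ => exact .capture (E := .hole) (E' := .hole) trivial trivial .hole h
  | @reset t t' h ih =>
    cases ih ht ht' with
    | value hv hv' => exact .step (.reset .hole _ hv) (.reset .hole _ hv') h
    | capture hE hE' hEE hb =>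
      exact .step (.shift .hole _ _ hE) (.shift .hole _ _ hE') (.reset (hb.inst hR hEE.reify))
    | step hr hr' hu => exact .step (hr.fill (.reset .hole)) (hr'.fill (.reset .hole)) (.reset hu)
    | apply hF hb hv hv' hvv => exact .apply (.reset hF) hb hv hv' hvv
    | base hF hb hv => exact .base (.reset hF) hb hv
  | @app t t' u u' htt huu iht ihu =>
    have huC : Clo R u u' := ⟨huu, ht.2, ht'.2⟩
    cases iht ht.1 ht'.1 with
    | capture hE hE' hEE hb =>
      exact .capture (E := .appT _ u) (E' := .appT _ u') hE hE' (.appT hEE huC) hb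
    | step hr hr' hs =>
      exact .step (hr.fill (.appT .hole u)) (hr'.fill (.appT .hole u')) (.app hs huu)
    | apply hF hb hv hv' hvv => exact .apply (.appT hF huC) hb hv hv' hvv
    | base hF hb hv => exact .base (.appT hF huC) hb hv
    | value hv hv' =>
      have htC : Clo R t t' := ⟨htt, ht.1, ht'.1⟩
      obtain ⟨b⟩ := hv
      obtain ⟨b'⟩ := hv'
      cases ihu ht.2 ht'.2 with
      | capture hE hE' hEE hb =>
        exact .capture (E := .appV b _) (E' := .appV b' _) hE hE' (.appV hEE htC) hb
      | step hr hr' hs =>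
        exact .step (hr.fill (.appV b .hole)) (hr'.fill (.appV b' .hole)) (.app htt hs)
      | apply hF hb hv hv' hvv => exact .apply (.appV hF htC) hb hv hv' hvv
      | base hF hb hv => exact .base (.appV hF htC) hb hv
      | value hu hu' =>
        cases htt with
        | base h => exact .apply (F := .hole) (F' := .hole) .hole h hu hu' huC
        | lam h => exact .step (.beta .hole b u hu) (.beta .hole b' u' hu') (h.inst hR huu)

/-- The joint cases for two related closed terms under a `reset`, where a captured context is no
obstacle to a reduction. -/
theorem Clo.reset_cases {R : TmRel} (hR : ValuePreserving R) {t t' : Tm} (h : Clo R t t') :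
    (t.IsValue ∧ t'.IsValue) ∨
    (∃ u u', Red (reset t) (reset u) ∧ Red (reset t') (reset u') ∧ Clo R u u') ∨
    (∃ F F' b b' v v', CloCtx R F F' ∧ (lam b, lam b') ∈ R ∧ v.IsValue ∧ v'.IsValue ∧
      Clo R v v' ∧ t = F.fill (app (lam b) v) ∧ t' = F'.fill (app (lam b') v')) ∨
    (∃ F F' s s', CloCtx R F F' ∧ (s, s') ∈ R ∧ ¬ s.IsValue ∧ t = F.fill s ∧
      t' = F'.fill s') := by
  obtain ⟨h, ht, ht'⟩ := h
  have key : ∀ u u', Red (reset t) (reset u) → Red (reset t') (reset u') → CloOpen R u u' →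
      ∃ u u', Red (reset t) (reset u) ∧ Red (reset t') (reset u') ∧ Clo R u u' :=
    fun u u' hr hr' hu => ⟨u, u', hr, hr', hu, hr.closed ht, hr'.closed ht'⟩
  cases h.jointEval hR ht ht' with
  | value hv hv' => exact .inl ⟨hv, hv'⟩
  | capture hE hE' hEE hb =>
    exact .inr (.inl (key _ _ (.shift .hole _ _ hE) (.shift .hole _ _ hE')
      (hb.inst hR hEE.reify)))
  | step hr hr' hu =>
    exact .inr (.inl (key _ _ (hr.fill (.reset .hole)) (hr'.fill (.reset .hole)) hu))
  | apply hF hb hv hv' hvv =>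
    exact .inr (.inr (.inl ⟨_, _, _, _, _, _, hF, hb, hv, hv', hvv, rfl, rfl⟩))
  | base hF hb hv => exact .inr (.inr (.inr ⟨_, _, _, _, hF, hb, hv, rfl, rfl⟩))

theorem Tm.IsValue.evalsToValue_reset {v : Tm} (hv : v.IsValue) : EvalsToValue (reset v) :=
  (Red.evalsToValue_iff (.reset .hole v hv)).2 hv.evalsToValue

/-- A closed term under a `reset` never gets stuck. -/
theorem Tm.Closed.reset_cases {t : Tm} (ht : t.Closed) :
    t.IsValue ∨ ∃ u, Red (reset t) (reset u) := by
  rcases (Clo.refl ∅ ht).reset_cases (fun _ _ h => h.elim) with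
    h | ⟨u, _, h, _⟩ | ⟨_, _, _, _, _, _, _, h, _⟩ | ⟨_, _, _, _, _, h, _⟩
  · exact .inl h.1
  · exact .inr ⟨u, h⟩
  · exact h.elim
  · exact h.elim

theorem evalsToValue_of_reset_reset {t : Tm} (ht : t.Closed)
    (h : EvalsToValue (reset (reset t))) : EvalsToValue (reset t) := by
  obtain ⟨n, hn⟩ := evalsToValue_iff_haltsIn.1 h
  clear h
  induction n using Nat.strong_induction_on generalizing t with
  | _ n ih =>
    rcases ht.reset_cases with hv | ⟨u, hu⟩
    · exact hv.evalsToValue_reset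
    · obtain ⟨m, hm, hmu⟩ := hn.of_red (hu.fill (.reset .hole))
      exact hu.evalsToValue_iff.2 (ih m hm (hu.closed ht) hmu)

/-! ### The context lemma -/

theorem Ctx.fill_cloOpen {R : TmRel} (C : Ctx) {t t' : Tm} (h : CloOpen R t t') :
    CloOpen R (C.fill t) (C.fill t') := by
  induction C with
  | hole => exact h
  | lam C ih => exact .lam ih
  | appR u C ih => exact .app (.refl R u) ih
  | appL C u ih => exact .app ih (.refl R u)
  | shift C ih => exact .shift ih
  | reset C ih => exact .reset ih

theorem Ctx.closedAt_fill_of_closed {C : Ctx} {t u : Tm} (hu : u.Closed) : ∀ {n : ℕ},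
    (C.fill t).ClosedAt n → (C.fill u).ClosedAt n := by
  induction C with
  | hole => intro n _; exact ClosedAt.mono hu (Nat.zero_le n)
  | lam C ih => intro n h; exact ih (n := n + 1) h
  | appR s C ih => intro n h; exact ⟨h.1, ih h.2⟩
  | appL C s ih => intro n h; exact ⟨ih h.1, h.2⟩
  | shift C ih => intro n h; exact ih (n := n + 1) h
  | reset C ih => intro n h; exact ih (n := n) h

/-- The closed term `t` delayed by one reduction step: `(lam _. t) (lam x. x)`. -/
def delay (t : Tm) : Tm := app (lam t) (lam (var 0))

theorem closed_delay {t : Tm} (ht : t.Closed) : (delay t).Closed :=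
  ⟨ClosedAt.mono (m := 1) ht (Nat.zero_le _), by simp [ClosedAt]⟩

theorem red_reset_fill_delay {t : Tm} (ht : t.Closed) (F : ECtx) :
    Red (reset (F.fill (delay t))) (reset (F.fill t)) := by
  have h := red_beta F (b := t) (Tm.IsValue.lam (var 0))
  rwa [Tm.inst, ht.subst_eq] at h

theorem valuePreserving_delay {t t' : Tm} (ht : t.Closed) (ht' : t'.Closed) :
    ValuePreserving {(delay t, t')} := by
  rintro s s' h
  obtain ⟨rfl, rfl⟩ := Prod.mk.inj h
  exact ⟨closed_delay ht, ht', fun h => nomatch h⟩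

/-- The relation of `delay t` to `t'` has no pair of functions and one pair of non-values, which
leaves three joint cases. -/
theorem Clo.delay_cases {t t' : Tm} (ht : t.Closed) (ht' : t'.Closed) {s s' : Tm}
    (h : Clo {(delay t, t')} s s') :
    (s.IsValue ∧ s'.IsValue) ∨
    (∃ u u', Red (reset s) (reset u) ∧ Red (reset s') (reset u') ∧
      Clo {(delay t, t')} u u') ∨
    (∃ F F', CloCtx {(delay t, t')} F F' ∧ s = F.fill (delay t) ∧ s' = F'.fill t') := by
  rcases h.reset_cases (valuePreserving_delay ht ht') with
    h | h | ⟨_, _, _, _, _, _, _, h, _⟩ | ⟨F, F', r, r', hF, h, -, h₁, h₂⟩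
  · exact .inl h
  · exact .inr (.inl h)
  · exact absurd (Prod.mk.inj h).1 (by simp [delay])
  · obtain ⟨rfl, rfl⟩ := Prod.mk.inj h
    exact .inr (.inr ⟨F, F', hF, h₁, h₂⟩)

/-- Replacing `delay t` by an equivalent of `t` preserves termination. When `delay t` comes to
evaluation position, the step it takes makes room for the induction hypothesis, which is used on
`F[t]` and `F'[t]`; the assumption then exchanges the last `t` for `t'`. -/
theorem CtxEquivEP.evalsToValue_of_delay {t t' : Tm} (h : CtxEquivEP t t') {s s' : Tm}
    (hs : Clo {(delay t, t')} s s') (hv : EvalsToValue (reset s)) : EvalsToValue (reset s') := by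
  obtain ⟨n, hn⟩ := evalsToValue_iff_haltsIn.1 hv
  clear hv
  induction n using Nat.strong_induction_on generalizing s s' with
  | _ n ih =>
    rcases hs.delay_cases h.1 h.2.1 with hv | ⟨u, u', hu, hu', huu⟩ | ⟨F, F', hF, rfl, rfl⟩
    · exact hv.2.evalsToValue_reset
    · obtain ⟨m, hm, hmu⟩ := hn.of_red hu
      exact hu'.evalsToValue_iff.2 (ih m hm huu hmu)
    · obtain ⟨m, hm, hmu⟩ := hn.of_red (red_reset_fill_delay h.1 F)
      exact (h.2.2 F' hF.closed.2).1 (ih m hm (hF.fill_clo (.refl _ h.1)) hmu)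

theorem sizeOf_fill_lt {t u : Tm} (h : sizeOf t < sizeOf u) (F : ECtx) :
    sizeOf (F.fill t) < sizeOf (F.fill u) := by
  induction F <;> simp [ECtx.fill] <;> omega

/-- Delaying a term preserves termination. The terms `delay t` at evaluation position take a step
that the undelayed side does not, but one that makes the term smaller. -/
theorem evalsToValue_delay {t : Tm} (ht : t.Closed) {s s' : Tm}
    (hs : Clo {(delay t, t)} s s') (hv : EvalsToValue (reset s')) : EvalsToValue (reset s) := by
  obtain ⟨n, hn⟩ := evalsToValue_iff_haltsIn.1 hv
  clear hv
  induction n using Nat.strong_induction_on generalizing s s' with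
  | _ n ihn =>
    induction hk : sizeOf s using Nat.strong_induction_on generalizing s s' with
    | _ k ihk =>
      rcases hs.delay_cases ht ht with hv | ⟨u, u', hu, hu', huu⟩ | ⟨F, F', hF, rfl, rfl⟩
      · exact hv.1.evalsToValue_reset
      · obtain ⟨m, hm, hmu⟩ := hn.of_red hu'
        exact hu.evalsToValue_iff.2 (ihn m hm huu hmu)
      · have hlt : sizeOf (F.fill t) < k :=
          hk ▸ sizeOf_fill_lt (by simp [delay]; omega) F
        exact (red_reset_fill_delay ht F).evalsToValue_iff.2
          (ihk _ hlt (hF.fill_clo (.refl _ ht)) hn rfl)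

theorem CtxEquivEP.symm {t t' : Tm} (h : CtxEquivEP t t') : CtxEquivEP t' t :=
  ⟨h.2.1, h.1, fun F hF => (h.2.2 F hF).symm⟩

theorem CtxEquivEP.ctxEquivP {t t' : Tm} (h : CtxEquivEP t t') : CtxEquivP t t' := by
  have key : ∀ {t t' : Tm}, CtxEquivEP t t' → ∀ C : Ctx, (C.fill t).Closed →
      EvalsToValue (reset (C.fill t)) → EvalsToValue (reset (C.fill t')) := by
    intro t t' h C hC hv
    have hd : (C.fill (delay t)).Closed := C.closedAt_fill_of_closed (closed_delay h.1) hC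
    refine h.evalsToValue_of_delay (s := C.fill (delay t))
      ⟨C.fill_cloOpen (.base rfl), hd, C.closedAt_fill_of_closed h.2.1 hC⟩ ?_
    exact evalsToValue_delay h.1 ⟨C.fill_cloOpen (.base rfl), hd, hC⟩ hv
  exact fun C h₀ h₁ => ⟨key h C h₀, key h.symm C h₁⟩

/-- An evaluation context as a one-hole context. -/
def ECtx.toCtx : ECtx → Ctx
  | hole => .hole
  | appV b F => .appR (lam b) F.toCtx
  | appT F t => .appL F.toCtx t
  | reset F => .reset F.toCtx

theorem ECtx.fill_toCtx (F : ECtx) (t : Tm) : F.toCtx.fill t = F.fill t := by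
  induction F <;> simp [ECtx.toCtx, ECtx.fill, Ctx.fill, *]

theorem CtxEquivP.ctxEquivEP {t t' : Tm} (ht : t.Closed) (ht' : t'.Closed)
    (h : CtxEquivP t t') : CtxEquivEP t t' := by
  refine ⟨ht, ht', fun F hF => ?_⟩
  have := h F.toCtx
  rw [F.fill_toCtx, F.fill_toCtx] at this
  exact this (ECtx.closedAt_fill hF ht) (ECtx.closedAt_fill hF ht')

/-! ### Symmetry of bisimilarity -/

/-- The converse of a relation. -/
def converse (R : TmRel) : TmRel := Prod.swap ⁻¹' R

theorem IsEnv.converse {e : TmRel} (he : IsEnv e) : IsEnv (converse e) :=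
  fun v w h => (he w v h).symm

theorem CloOpen.converse {R : TmRel} {t t' : Tm} (h : CloOpen R t t') :
    CloOpen (converse R) t' t := by
  induction h with
  | base h => exact .base h
  | var n => exact .var n
  | lam _ ih => exact .lam ih
  | app _ _ iht ihu => exact .app iht ihu
  | shift _ ih => exact .shift ih
  | reset _ ih => exact .reset ih

theorem Clo.converse {R : TmRel} {t t' : Tm} (h : Clo R t t') : Clo (converse R) t' t :=
  ⟨h.1.converse, h.2.2, h.2.1⟩

theorem CloCtx.converse {R : TmRel} {F F' : ECtx} (h : CloCtx R F F') :
    CloCtx (converse R) F' F := by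
  induction h with
  | hole => exact .hole
  | appV _ hb ih => exact .appV ih hb.converse
  | appT _ hu ih => exact .appT ih hu.converse
  | reset _ ih => exact .reset ih

theorem converse_insert (v w : Tm) (e : TmRel) :
    converse (insert (v, w) e) = insert (w, v) (converse e) := by
  ext ⟨a, b⟩
  simp [converse, and_comm]

/-- The converse of an environmental relation. -/
def EnvRel.converse (R : EnvRel) : EnvRel where
  envs := {e | LamShift.converse e ∈ R.envs}
  triples := {x | (LamShift.converse x.1, x.2.2, x.2.1) ∈ R.triples}
  isEnv_of_mem := fun _ h => (R.isEnv_of_mem _ h).converse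
  wf_of_mem := fun _ _ _ h =>
    ⟨(R.wf_of_mem _ _ _ h).1.converse, (R.wf_of_mem _ _ _ h).2.symm⟩

theorem IsBisimP.converse {R : EnvRel} (hR : IsBisimP R) : IsBisimP R.converse where
  plug := fun e _ _ h hn _ _ h₀ h₁ hE =>
    hR.plug _ _ _ h (fun hp => hn hp.symm) _ _ h₁ h₀ hE.converse
  stepL := fun _ _ _ h h₀ h₁ => hR.stepR _ _ _ h h₁ h₀
  stepR := fun _ _ _ h h₀ h₁ => hR.stepL _ _ _ h h₁ h₀
  valueL := fun e _ _ h h₀ h₁ v₀ hv hr => by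
    obtain ⟨v₁, hv₁, hr₁, hm⟩ := hR.valueR _ _ _ h h₁ h₀ v₀ hv hr
    exact ⟨v₁, hv₁, hr₁, by rw [← converse_insert] at hm; exact hm⟩
  valueR := fun e _ _ h h₀ h₁ v₁ hv hr => by
    obtain ⟨v₀, hv₀, hr₀, hm⟩ := hR.valueL _ _ _ h h₁ h₀ v₁ hv hr
    exact ⟨v₀, hv₀, hr₀, by rw [← converse_insert] at hm; exact hm⟩
  apply := fun _ he _ _ hb _ _ h₀ h₁ hv => hR.apply _ he _ _ hb _ _ h₁ h₀ hv.converse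

theorem EmpBisimP.symm {t t' : Tm} (h : EmpBisimP t t') : EmpBisimP t' t := by
  obtain ⟨R, hR, h⟩ := h
  exact ⟨R.converse, hR.converse, h⟩

/-! ### Bisimilarity implies equivalence in evaluation contexts -/

/-- Related contexts are both pure, or both have a `reset` around the hole; the innermost one
splits off related pure contexts. -/
theorem CloCtx.pure_or_split {R : TmRel} {F F' : ECtx} (h : CloCtx R F F') :
    (F.IsPure ∧ F'.IsPure) ∨ ∃ G G' E E', CloCtx R G G' ∧ CloCtx R E E' ∧ E.IsPure ∧ E'.IsPure ∧
      F = G.comp (.reset E) ∧ F' = G'.comp (.reset E') := by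
  induction h with
  | hole => exact .inl ⟨trivial, trivial⟩
  | appV _ hb ih =>
    rcases ih with ih | ⟨G, G', E, E', hG, hE, h₀, h₁, rfl, rfl⟩
    · exact .inl ih
    · exact .inr ⟨_, _, E, E', .appV hG hb, hE, h₀, h₁, rfl, rfl⟩
  | appT _ hu ih =>
    rcases ih with ih | ⟨G, G', E, E', hG, hE, h₀, h₁, rfl, rfl⟩
    · exact .inl ih
    · exact .inr ⟨_, _, E, E', .appT hG hu, hE, h₀, h₁, rfl, rfl⟩
  | reset hF ih =>
    rcases ih with ih | ⟨G, G', E, E', hG, hE, h₀, h₁, rfl, rfl⟩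
    · exact .inr ⟨.hole, .hole, _, _, .hole, hF, ih.1, ih.2, rfl, rfl⟩
    · exact .inr ⟨_, _, E, E', .reset hG, hE, h₀, h₁, rfl, rfl⟩

/-- One half of the adequacy of a bisimulation, by induction on the number of steps of the left
term: for terms related by the closure of an environment, for programs of a triple, alone or in
related contexts below a `reset`, and for arbitrary terms of a triple in such contexts. -/
theorem IsBisimP.evalsToValue_aux {R : EnvRel} (hR : IsBisimP R) (n : ℕ) :
    (∀ e ∈ R.envs, ∀ s s', Clo e s s' → HaltsIn n (reset s) → EvalsToValue (reset s')) ∧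
    (∀ e p p', (e, p, p') ∈ R.triples → p.IsProgram → p'.IsProgram →
      (HaltsIn n p → EvalsToValue p') ∧
      ∀ F F', CloCtx e F F' → HaltsIn n (reset (F.fill p)) →
        EvalsToValue (reset (F'.fill p'))) ∧
    (∀ e t t', (e, t, t') ∈ R.triples → ∀ F F', CloCtx e F F' →
      HaltsIn n (reset (F.fill t)) → EvalsToValue (reset (F'.fill t'))) := by
  induction n using Nat.strong_induction_on with
  | _ n ih =>
    have prog : ∀ e p p', (e, p, p') ∈ R.triples → p.IsProgram → p'.IsProgram →
        (HaltsIn n p → EvalsToValue p') ∧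
        ∀ F F', CloCtx e F F' → HaltsIn n (reset (F.fill p)) →
          EvalsToValue (reset (F'.fill p')) := by
      intro e p p' h hp hp'
      have hc := R.wf_of_mem _ _ _ h
      obtain ⟨t⟩ := hp
      rcases Tm.Closed.reset_cases (t := t) hc.2.1 with hv | ⟨u, hu⟩
      · have hr : Red (reset t) t := .reset .hole t hv
        obtain ⟨v', hv', hr', he⟩ := hR.valueL _ _ _ h ⟨t⟩ hp' t hv hr
        refine ⟨fun _ => (Reds.evalsToValue_iff hr').2 hv'.evalsToValue, fun F F' hF hn => ?_⟩
        obtain ⟨m, hm, hmu⟩ := hn.of_red (hr.fill (.reset F))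
        refine (Reds.evalsToValue_iff (hr'.fill (.reset F'))).2
          ((ih m hm).1 _ he _ _ ((hF.mono (Set.subset_insert _ _)).fill_clo ?_) hmu)
        exact ⟨.base (Set.mem_insert _ _), hr.closed hc.2.1, Reds.closed hr' hc.2.2⟩
      · obtain ⟨q, hq, hr', h'⟩ := hR.stepL _ _ _ h ⟨t⟩ hp' _ ⟨u⟩ hu
        refine ⟨fun hn => ?_, fun F F' hF hn => ?_⟩
        · obtain ⟨m, hm, hmu⟩ := hn.of_red hu
          exact (Reds.evalsToValue_iff hr').2 (((ih m hm).2.1 _ _ _ h' ⟨u⟩ hq).1 hmu)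
        · obtain ⟨m, hm, hmu⟩ := hn.of_red (hu.fill (.reset F))
          exact (Reds.evalsToValue_iff (hr'.fill (.reset F'))).2
            (((ih m hm).2.1 _ _ _ h' ⟨u⟩ hq).2 F F' hF hmu)
    refine ⟨?_, prog, ?_⟩
    · intro e he s s' hs hn
      have hE := R.isEnv_of_mem e he
      rcases hs.reset_cases hE.valuePreserving with hv | ⟨u, u', hu, hu', huu⟩ |
          ⟨F, F', b, b', v, v', hF, hb, hv, hv', hvv, rfl, rfl⟩ | ⟨_, _, _, _, _, h, hnv, _⟩
      · exact hv.2.evalsToValue_reset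
      · obtain ⟨m, hm, hmu⟩ := hn.of_red hu
        exact hu'.evalsToValue_iff.2 ((ih m hm).1 e he _ _ huu hmu)
      · obtain ⟨m, hm, hmu⟩ := hn.of_red (red_beta F hv)
        exact (red_beta F' hv').evalsToValue_iff.2
          ((ih m hm).2.2 _ _ _ (hR.apply e he b b' hb v v' hv hv' hvv) F F' hF hmu)
      · exact absurd (hE _ _ h).1.1 hnv
    · intro e t t' h F F' hF hn
      by_cases hp : t.IsProgram ∧ t'.IsProgram
      · exact (prog e t t' h hp.1 hp.2).2 F F' hF hn
      · rcases hF.pure_or_split with hpure | ⟨G, G', E, E', hG, hE, h₀, h₁, rfl, rfl⟩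
        · exact (prog _ _ _ (hR.plug e t t' h hp F F' hpure.1 hpure.2 hF) ⟨_⟩ ⟨_⟩).1 hn
        · rw [ECtx.fill_comp] at hn ⊢
          exact (prog _ _ _ (hR.plug e t t' h hp E E' h₀ h₁ hE) ⟨_⟩ ⟨_⟩).2 G G' hG hn

theorem EmpBisimP.ctxEquivEP {t t' : Tm} (h : EmpBisimP t t') : CtxEquivEP t t' := by
  have key : ∀ {t t' : Tm}, EmpBisimP t t' → ∀ F : ECtx, F.Closed →
      EvalsToValue (reset (F.fill t)) → EvalsToValue (reset (F.fill t')) := by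
    intro t t' h F hF hv
    obtain ⟨n, hn⟩ := evalsToValue_iff_haltsIn.1 hv
    exact (isBisimP_bisimilarityP.evalsToValue_aux n).2.2 _ _ _ h F F (.refl _ hF) hn
  have hc := bisimilarityP.wf_of_mem _ _ _ h
  exact ⟨hc.2.1, hc.2.2, fun F hF => ⟨key h F hF, key h.symm F hF⟩⟩

/-! ### Equivalence in evaluation contexts implies bisimilarity -/

/-- The pair added to a relation is abstracted out of related terms, as a variable. Below `n`
binders this is the variable `n`, and `σ`, `σ'` are the substitutions of the two components of the
pair for it. -/
theorem CloOpen.exists_abstract {e : TmRel} (he : IsEnv e) {v v' : Tm} (hv : v.Closed)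
    (hv' : v'.Closed) {s s' : Tm} (h : CloOpen (insert (v, v') e) s s') :
    ∀ {n : ℕ} {σ σ' : ℕ → Tm}, s.ClosedAt n → s'.ClosedAt n →
      (∀ i < n, σ i = Tm.var i) → (∀ i < n, σ' i = Tm.var i) → σ n = v → σ' n = v' →
      ∃ u u', CloOpen e u u' ∧ u.ClosedAt (n + 1) ∧ u'.ClosedAt (n + 1) ∧
        u.subst σ = s ∧ u'.subst σ' = s' := by
  have upLast : ∀ {n : ℕ} {σ : ℕ → Tm} {w : Tm}, w.Closed → σ n = w → upSub σ (n + 1) = w := by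
    intro n σ w hw h
    simp [upSub, h, hw.rename_eq]
  induction h with
  | @base t t' h =>
    intro n σ σ' _ _ hσ hσ' h₀ h₁
    rcases h with h | h
    · obtain ⟨rfl, rfl⟩ := Prod.mk.inj h
      exact ⟨Tm.var n, Tm.var n, .var n, Nat.lt_succ_self n, Nat.lt_succ_self n, h₀, h₁⟩
    · obtain ⟨⟨-, ht⟩, -, ht'⟩ := he _ _ h
      exact ⟨t, t', .base h, ClosedAt.mono ht (Nat.zero_le _), ClosedAt.mono ht' (Nat.zero_le _),
        ht.subst_eq σ, ht'.subst_eq σ'⟩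
  | var i =>
    intro n σ σ' hi _ hσ hσ' _ _
    have hi' : i < n + 1 := Nat.lt_succ_of_lt hi
    exact ⟨Tm.var i, Tm.var i, .var i, hi', hi', hσ i hi, hσ' i hi⟩
  | lam _ ih =>
    intro n σ σ' hs hs' hσ hσ' h₀ h₁
    obtain ⟨u, u', hu, hc, hc', rfl, rfl⟩ :=
      ih (n := n + 1) hs hs' (upSub_eq_var hσ) (upSub_eq_var hσ')
        (upLast hv h₀) (upLast hv' h₁)
    exact ⟨Tm.lam u, Tm.lam u', .lam hu, hc, hc', rfl, rfl⟩
  | shift _ ih =>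
    intro n σ σ' hs hs' hσ hσ' h₀ h₁
    obtain ⟨u, u', hu, hc, hc', rfl, rfl⟩ :=
      ih (n := n + 1) hs hs' (upSub_eq_var hσ) (upSub_eq_var hσ')
        (upLast hv h₀) (upLast hv' h₁)
    exact ⟨Tm.shift u, Tm.shift u', .shift hu, hc, hc', rfl, rfl⟩
  | reset _ ih =>
    intro n σ σ' hs hs' hσ hσ' h₀ h₁
    obtain ⟨u, u', hu, hc, hc', rfl, rfl⟩ := ih (n := n) hs hs' hσ hσ' h₀ h₁
    exact ⟨Tm.reset u, Tm.reset u', .reset hu, hc, hc', rfl, rfl⟩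
  | app _ _ iht ihu =>
    intro n σ σ' hs hs' hσ hσ' h₀ h₁
    obtain ⟨t, t', ht, htc, htc', rfl, rfl⟩ := iht hs.1 hs'.1 hσ hσ' h₀ h₁
    obtain ⟨u, u', hu, huc, huc', rfl, rfl⟩ := ihu hs.2 hs'.2 hσ hσ' h₀ h₁
    exact ⟨Tm.app t u, Tm.app t' u', .app ht hu, ⟨htc, huc⟩, ⟨htc', huc'⟩, rfl, rfl⟩

/-- Two terms terminate alike in all related contexts below a `reset`. -/
def SameTermination (e : TmRel) (t t' : Tm) : Prop :=
  ∀ F F', CloCtx e F F' →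
    (EvalsToValue (reset (F.fill t)) ↔ EvalsToValue (reset (F'.fill t')))

/-- The environmental relation of observational equivalence: environments whose closure relates
terms that terminate alike below a `reset`, and terms that terminate alike in related contexts. -/
def observational : EnvRel where
  envs := {e | IsEnv e ∧
    ∀ s s', Clo e s s' → (EvalsToValue (reset s) ↔ EvalsToValue (reset s'))}
  triples := {x | IsEnv x.1 ∧ x.2.1.Closed ∧ x.2.2.Closed ∧ SameTermination x.1 x.2.1 x.2.2}
  isEnv_of_mem := fun _ h => h.1
  wf_of_mem := fun _ _ _ h => ⟨h.1, h.2.1, h.2.2.1⟩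

/-- Terms that terminate alike and have values provide an environment with these values: related
terms built from them are the values of related functions applied to the two terms. -/
theorem SameTermination.insert_mem_envs {e : TmRel} (he : IsEnv e) {t t' v v' : Tm}
    (h : SameTermination e t t') (hv : v.IsValue) (hv' : v'.IsValue) (hvc : v.Closed)
    (hvc' : v'.Closed) (hr : Reds t v) (hr' : Reds t' v') :
    insert (v, v') e ∈ observational.envs := by
  refine ⟨?_, fun s s' hs => ?_⟩
  · rintro w w' (hw | hw)
    · obtain ⟨rfl, rfl⟩ := Prod.mk.inj hw
      exact ⟨⟨hv, hvc⟩, hv', hvc'⟩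
    · exact he w w' hw
  · obtain ⟨u, u', hu, hc, hc', rfl, rfl⟩ := hs.1.exists_abstract he hvc hvc' (n := 0)
      (σ := single v) (σ' := single v') hs.2.1 hs.2.2 (by simp) (by simp) rfl rfl
    have := h (.appV u .hole) (.appV u' .hole) (.appV .hole ⟨.lam hu, hc, hc'⟩)
    have hl := Reds.evalsToValue_iff
      ((hr.fill (.reset (.appV u .hole))).tail (red_beta .hole hv))
    have hl' := Reds.evalsToValue_iff
      ((hr'.fill (.reset (.appV u' .hole))).tail (red_beta .hole hv'))
    exact hl.symm.trans (this.trans hl')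

theorem Tm.IsProgram.exists_reds_value {p : Tm} (hp : p.IsProgram) (hc : p.Closed)
    (h : EvalsToValue (Tm.reset p)) : ∃ v : Tm, v.IsValue ∧ Reds p v := by
  obtain ⟨t⟩ := hp
  obtain ⟨v, hv, hr, -⟩ := evalsToValue_of_reset_reset (t := t) hc h
  exact ⟨v, hv, hr⟩

theorem isBisimP_observational : IsBisimP observational where
  plug := by
    rintro e t t' ⟨he, ht, ht', h⟩ - E E' - - hE
    refine ⟨he, ECtx.closedAt_fill hE.closed.1 ht, ECtx.closedAt_fill hE.closed.2 ht',
      fun F F' hF => ?_⟩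
    have := h _ _ (hF.comp (.reset hE))
    rwa [ECtx.fill_comp, ECtx.fill_comp] at this
  stepL := by
    rintro e p p' ⟨he, hp, hp', h⟩ - hpr q hq hr
    exact ⟨p', hpr, .refl, he, hr.closed hp, hp', fun F F' hF =>
      (hr.fill (.reset F)).evalsToValue_iff.symm.trans (h F F' hF)⟩
  stepR := by
    rintro e p p' ⟨he, hp, hp', h⟩ hpr - q hq hr
    exact ⟨p, hpr, .refl, he, hp, hr.closed hp', fun F F' hF =>
      (h F F' hF).trans (hr.fill (.reset F')).evalsToValue_iff⟩
  valueL := by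
    rintro e p p' ⟨he, hp, hp', h⟩ - hpr v hv hr
    have h' := (h .hole .hole .hole).1
      ((hr.fill (.reset .hole)).evalsToValue_iff.2 hv.evalsToValue_reset)
    obtain ⟨v', hv', hr'⟩ := hpr.exists_reds_value hp' h'
    exact ⟨v', hv', hr', h.insert_mem_envs he hv hv' (hr.closed hp) (Reds.closed hr' hp')
      (.single hr) hr'⟩
  valueR := by
    rintro e p p' ⟨he, hp, hp', h⟩ hpr - v' hv' hr'
    have h' := (h .hole .hole .hole).2
      ((hr'.fill (.reset .hole)).evalsToValue_iff.2 hv'.evalsToValue_reset)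
    obtain ⟨v, hv, hr⟩ := hpr.exists_reds_value hp h'
    exact ⟨v, hv, hr, h.insert_mem_envs he hv hv' (Reds.closed hr hp) (hr'.closed hp')
      hr (.single hr')⟩
  apply := by
    rintro e ⟨he, h⟩ b b' hb v v' hv hv' hvv
    obtain ⟨⟨-, hbc⟩, -, hbc'⟩ := he _ _ hb
    refine ⟨he, ClosedAt.inst hbc hvv.2.1, ClosedAt.inst hbc' hvv.2.2, fun F F' hF => ?_⟩
    have := h _ _ (hF.fill_clo ⟨.app (.base hb) hvv.1, ⟨hbc, hvv.2.1⟩, ⟨hbc', hvv.2.2⟩⟩)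
    rwa [(red_beta F hv).evalsToValue_iff, (red_beta F' hv').evalsToValue_iff] at this

theorem CtxEquivEP.empBisimP {t t' : Tm} (h : CtxEquivEP t t') : EmpBisimP t t' := by
  refine isBisimP_observational.le_bisimilarityP.2
    ⟨fun _ _ h => h.elim, h.1, h.2.1, fun F F' hF => ?_⟩
  obtain rfl := hF.eq_of_empty
  exact h.2.2 F hF.closed.1

end LamShift

theorem lemmal :
    (∀ t₀ t₁ : LamShift.Tm, LamShift.CtxEquivEP t₀ t₁ → LamShift.EmpBisimP t₀ t₁) ∧
    (∀ t₀ t₁ : LamShift.Tm, t₀.Closed → t₁.Closed →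
      (LamShift.CtxEquivP t₀ t₁ ↔ LamShift.CtxEquivEP t₀ t₁) ∧
      (LamShift.CtxEquivEP t₀ t₁ ↔ LamShift.EmpBisimP t₀ t₁) ∧
      (LamShift.EmpBisimP t₀ t₁ ↔ LamShift.CtxEquivP t₀ t₁)) :=
  ⟨fun _ _ h => h.empBisimP, fun _ _ h₀ h₁ =>
    ⟨⟨fun h => h.ctxEquivEP h₀ h₁, fun h => h.ctxEquivP⟩,
      ⟨fun h => h.empBisimP, fun h => h.ctxEquivEP⟩,
      ⟨fun h => h.ctxEquivEP.ctxEquivP, fun h => (h.ctxEquivEP h₀ h₁).empBisimP⟩⟩⟩
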